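/- Notation. For $t\in\mathbb R$ put $\langle t\rangle=(1+t^2)^{1/2}$. Let $\mathbb S=\mathbb R^2\times\mathbb R\times\mathbb R^{\times}$, $\mathbb R^\times=\mathbb R\setminus\{0\}$, be the standard shearlet group, with left Haar measure $d\mu(b,s,a)=|a|^{-3}\,db\,ds\,da$. For $(b,s,a)\in\mathbb S$ and $f\colon\mathbb R^2\to\mathbb C$ let $$\pi_{b,s,a}f(x)=|a|^{-3/4}f\bigl(A_a^{-1}N_s^{-1}(x-b)\bigr),\qquad N_s=\begin{pmatrix}1&-s\\0&1\end{pmatrix},\qquad A_a=a\begin{pmatrix}1&0\\0&|a|^{-1/2}\end{pmatrix}.$$ Let $\mathcal S_0(\mathbb R^2)$ be the Lizorkin space of all Schwartz functions $\varphi\in\mathcal S(\mathbb R^2)$ with $\int_{\mathbb R^2}x^m\varphi(x)\,dx=0$ for every $m\in\mathbb N^2$, with the topology inherited from $\mathcal S(\mathbb R^2)$. Let $\mathcal S(\mathbb S)$ be the space of all $\Phi\in C^\infty(\mathbb S)$ (complex valued) for which the norms $$\sup_{((b_1,b_2),s,a)\in\mathbb S}\langle b_1\rangle^{k_1}\langle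 b_2\rangle^{k_2}\langle s\rangle^{l}\Bigl(|a|^m+\frac1{|a|^m}\Bigr)\bigl|\partial_a^\gamma\partial_s^\beta\partial_{b_2}^{\alpha_2}\partial_{b_1}^{\alpha_1}\Phi((b_1,b_2),s,a)\bigr|$$ are finite for all $k_1,k_2,l,m,\alpha_1,\alpha_2,\beta,\gamma\in\mathbb N=\{0,1,2,\dots\}$, with the locally convex topology defined by these norms. Theorem. For all $F\in\mathcal S(\mathbb S)$, $\psi\in\mathcal S_0(\mathbb R^2)$ and $x\in\mathbb R^2$ the integral $$\mathcal S^t_\psi F(x)=\int_{\mathbb S}F(b,s,a)\,\pi_{b,s,a}\psi(x)\,d\mu(b,s,a)$$ converges absolutely, the function $\mathcal S^t_\psi F$ belongs to $\mathcal S_0(\mathbb R^2)$, and the map $(F,\psi)\mapsto\mathcal S^t_\psi F$ is a (jointly) continuous bilinear map from $\mathcal S(\mathbb S)\times\mathcal S_0(\mathbb R^2)$ into $\mathcal S_0(\mathbb R^2)$. In particular, for every $\psi\in\mathcal S_0(\mathbb R^2)$ the shearlet synthesis operator $\mathcal S^t_\psi\colon\mathcal S(\mathbb S)\to\mathcal S_0(\mathbb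 R^2)$ is continuous. -/

import Mathlib

open MeasureTheory
open scoped SchwartzMap ContDiff

noncomputable section

/-- The Euclidean plane. -/
abbrev Plane : Type := EuclideanSpace ℝ (Fin 2)

/-! ### The Lizorkin space -/

/-- A monomial times a Schwartz function is integrable. -/
theorem integrable_monomial_mul_schwartz {d : ℕ} (m : Fin d → ℕ)
    (φ : 𝓢(EuclideanSpace ℝ (Fin d), ℂ)) :
    Integrable (fun x : EuclideanSpace ℝ (Fin d) => ((∏ i, x i ^ m i : ℝ) : ℂ) * φ x) := by
  refine (φ.integrable_pow_mul volume (∑ i, m i)).mono' ?_ ?_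
  · refine Continuous.aestronglyMeasurable ?_
    have := φ.continuous
    fun_prop
  · refine Filter.Eventually.of_forall fun x => ?_
    rw [norm_mul, Complex.norm_real, norm_prod]
    refine mul_le_mul_of_nonneg_right ?_ (norm_nonneg _)
    rw [← Finset.prod_pow_eq_pow_sum]
    refine Finset.prod_le_prod (fun i _ => norm_nonneg _) fun i _ => ?_
    rw [norm_pow]
    exact pow_le_pow_left₀ (norm_nonneg _) (PiLp.norm_apply_le x i) _

/-- The Lizorkin space `S₀(ℝᵈ)`: the Schwartz functions all of whose moments
`∫ x^m φ(x) dx`, `m ∈ ℕᵈ`, vanish. As a type it carries the relative topology of the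
Schwartz space. -/
def lizorkinSpace (d : ℕ) : Submodule ℂ 𝓢(EuclideanSpace ℝ (Fin d), ℂ) where
  carrier := {φ | ∀ m : Fin d → ℕ,
    ∫ x : EuclideanSpace ℝ (Fin d), ((∏ i, x i ^ m i : ℝ) : ℂ) * φ x = 0}
  zero_mem' := fun m => by simp
  add_mem' := by
    intro φ χ hφ hχ m
    have h := integral_add (integrable_monomial_mul_schwartz m φ)
      (integrable_monomial_mul_schwartz m χ)
    rw [hφ m, hχ m, add_zero] at h
    rw [← h]
    refine integral_congr_ae (Filter.Eventually.of_forall fun x => ?_)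
    simp [mul_add]
  smul_mem' := by
    intro c φ hφ m
    have h := integral_const_mul (μ := volume) c
      (fun x : EuclideanSpace ℝ (Fin d) => ((∏ i, x i ^ m i : ℝ) : ℂ) * φ x)
    rw [hφ m, mul_zero] at h
    rw [← h]
    refine integral_congr_ae (Filter.Eventually.of_forall fun x => ?_)
    simp [mul_left_comm]

/-! ### The shearlet group, its Haar measure and the shearlet representation -/

/-- The underlying space `ℝ² × ℝ × ℝ^×` of the standard shearlet group; its points are written
`(b, s, a)`. -/
abbrev ShearletGroup : Type := Plane × ℝ × {a : ℝ // a ≠ 0}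

/-- Lebesgue measure `da` on `ℝ^×`. -/
def lebesgueNeZero : Measure {a : ℝ // a ≠ 0} := (volume : Measure ℝ).comap Subtype.val

/-- The left Haar measure `dμ(b,s,a) = |a|⁻³ db ds da`. -/
def shearletHaar : Measure ShearletGroup :=
  ((volume : Measure Plane).prod ((volume : Measure ℝ).prod lebesgueNeZero)).withDensity fun p => ENNReal.ofReal ((|(p.2.2 : ℝ)| ^ 3)⁻¹)

/-- The shear matrix `N_s`. -/
def shearMatrix (s : ℝ) : Matrix (Fin 2) (Fin 2) ℝ := !![1, -s; 0, 1]

/-- The anisotropic dilation matrix `A_a`. -/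
def dilationMatrix (a : ℝ) : Matrix (Fin 2) (Fin 2) ℝ :=
  a • !![1, 0; 0, |a| ^ (-(1 / 2) : ℝ)]

/-- `π_{b,s,a} f (x) = |a|^{-3/4} f(A_a⁻¹ N_s⁻¹ (x - b))`. -/
def shearletRep (p : ShearletGroup) (f : Plane → ℂ) (x : Plane) : ℂ :=
  ((|(p.2.2 : ℝ)| ^ (-(3 / 4) : ℝ) : ℝ) : ℂ) *
    f (Matrix.toEuclideanLin ((dilationMatrix p.2.2)⁻¹ * (shearMatrix p.2.1)⁻¹) (x - p.1))

/-- The shearlet synthesis operator `S^t_ψ F(x) = ∫ F(b,s,a) π_{b,s,a}ψ(x) dμ(b,s,a)`. -/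
def shearletSynthesis (ψ : Plane → ℂ) (F : ShearletGroup → ℂ) (x : Plane) : ℂ :=
  ∫ p, F p * shearletRep p ψ x ∂shearletHaar

/-! ### The space of highly localized functions on the shearlet group -/

/-- The inclusion of the shearlet group in `ℝ² × ℝ × ℝ` as the open set `a ≠ 0`. -/
def shearletIncl (p : ShearletGroup) : Plane × ℝ × ℝ := (p.1, p.2.1, p.2.2)

/-- Extension by zero of a function on the shearlet group to `ℝ² × ℝ × ℝ`. -/
def shearletExt (Φ : ShearletGroup → ℂ) (q : Plane × ℝ × ℝ) : ℂ :=
  open Classical in if h : q.2.2 ≠ 0 then Φ (q.1, q.2.1, ⟨q.2.2, h⟩) else 0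

/-- `Φ ∈ C^∞`, as a function on the open subset `a ≠ 0` of `ℝ² × ℝ × ℝ`. -/
def ShearletSmooth (Φ : ShearletGroup → ℂ) : Prop :=
  ContDiffOn ℝ ∞ (shearletExt Φ) {q | q.2.2 ≠ 0}

/-- The derivative of a function on the shearlet group in the coordinate direction `v`. -/
def shearletDeriv (v : Plane × ℝ × ℝ) (Φ : ShearletGroup → ℂ) (p : ShearletGroup) : ℂ :=
  fderiv ℝ (shearletExt Φ) (shearletIncl p) v

/-- The eight indices of the norms on the space of highly localized functions. -/
structure ShearletIndex where
  (k₁ k₂ l m α₁ α₂ β γ : ℕ)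

/-- `∂_a^γ ∂_s^β ∂_{b₂}^{α₂} ∂_{b₁}^{α₁} Φ`. -/
def shearletPartial (i : ShearletIndex) (Φ : ShearletGroup → ℂ) : ShearletGroup → ℂ :=
  (shearletDeriv (0, 0, 1))^[i.γ] <| (shearletDeriv (0, 1, 0))^[i.β] <|
    (shearletDeriv (EuclideanSpace.single 1 1, 0, 0))^[i.α₂] <|
      (shearletDeriv (EuclideanSpace.single 0 1, 0, 0))^[i.α₁] Φ

/-- `⟨b₁⟩^{k₁} ⟨b₂⟩^{k₂} ⟨s⟩^l (|a|^m + 1/|a|^m)`, where `⟨t⟩ = (1 + t²)^{1/2}`. -/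
def shearletWeight (i : ShearletIndex) (p : ShearletGroup) : ℝ :=
  √(1 + p.1 0 ^ 2) ^ i.k₁ * √(1 + p.1 1 ^ 2) ^ i.k₂ * √(1 + p.2.1 ^ 2) ^ i.l *
    (|(p.2.2 : ℝ)| ^ i.m + 1 / |(p.2.2 : ℝ)| ^ i.m)

theorem shearletWeight_nonneg (i : ShearletIndex) (p : ShearletGroup) :
    0 ≤ shearletWeight i p := by
  unfold shearletWeight; positivity

theorem shearletExt_incl (Φ : ShearletGroup → ℂ) (p : ShearletGroup) :
    shearletExt Φ (shearletIncl p) = Φ p := by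
  simp [shearletExt, shearletIncl, p.2.2.2]

theorem isOpen_shearletRange : IsOpen {q : Plane × ℝ × ℝ | q.2.2 ≠ 0} :=
  isOpen_ne_fun (by fun_prop) continuous_const

theorem shearletExt_add (Φ Ψ : ShearletGroup → ℂ) :
    shearletExt (Φ + Ψ) = shearletExt Φ + shearletExt Ψ := by
  ext q; by_cases h : q.2.2 ≠ 0 <;> simp [shearletExt, h]

theorem shearletExt_smul (c : ℂ) (Φ : ShearletGroup → ℂ) :
    shearletExt (c • Φ) = c • shearletExt Φ := by
  ext q; by_cases h : q.2.2 ≠ 0 <;> simp [shearletExt, h]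

theorem shearletExt_zero : shearletExt 0 = 0 := by
  ext q; by_cases h : q.2.2 ≠ 0 <;> simp [shearletExt, h]

theorem ShearletSmooth.zero : ShearletSmooth 0 := by
  unfold ShearletSmooth; rw [shearletExt_zero]; exact contDiffOn_const

theorem ShearletSmooth.add {Φ Ψ : ShearletGroup → ℂ} (hΦ : ShearletSmooth Φ)
    (hΨ : ShearletSmooth Ψ) : ShearletSmooth (Φ + Ψ) := by
  unfold ShearletSmooth; rw [shearletExt_add]; exact ContDiffOn.add hΦ hΨ

theorem ShearletSmooth.smul (c : ℂ) {Φ : ShearletGroup → ℂ} (hΦ : ShearletSmooth Φ) :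
    ShearletSmooth (c • Φ) := by
  unfold ShearletSmooth; rw [shearletExt_smul]; exact contDiffOn_const.smul hΦ

theorem ShearletSmooth.differentiableAt {Φ : ShearletGroup → ℂ} (hΦ : ShearletSmooth Φ)
    (p : ShearletGroup) : DifferentiableAt ℝ (shearletExt Φ) (shearletIncl p) :=
  (ContDiffOn.differentiableOn hΦ (by simp)).differentiableAt
    (isOpen_shearletRange.mem_nhds p.2.2.2)

theorem ShearletSmooth.deriv (v : Plane × ℝ × ℝ) {Φ : ShearletGroup → ℂ}
    (hΦ : ShearletSmooth Φ) : ShearletSmooth (shearletDeriv v Φ) := by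
  have h : ContDiffOn ℝ ∞ (fun q => fderiv ℝ (shearletExt Φ) q v) {q | q.2.2 ≠ 0} :=
    (ContDiffOn.fderiv_of_isOpen hΦ isOpen_shearletRange (by simp)).clm_apply contDiffOn_const
  refine h.congr fun q hq => ?_
  exact shearletExt_incl (shearletDeriv v Φ) (q.1, q.2.1, ⟨q.2.2, hq⟩)

theorem shearletDeriv_add (v : Plane × ℝ × ℝ) {Φ Ψ : ShearletGroup → ℂ}
    (hΦ : ShearletSmooth Φ) (hΨ : ShearletSmooth Ψ) :
    shearletDeriv v (Φ + Ψ) = shearletDeriv v Φ + shearletDeriv v Ψ := by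
  ext p
  simp only [shearletDeriv, shearletExt_add, Pi.add_apply]
  rw [fderiv_add (hΦ.differentiableAt p) (hΨ.differentiableAt p)]
  simp

theorem shearletDeriv_smul (v : Plane × ℝ × ℝ) (c : ℂ) {Φ : ShearletGroup → ℂ}
    (hΦ : ShearletSmooth Φ) : shearletDeriv v (c • Φ) = c • shearletDeriv v Φ := by
  ext p
  simp only [shearletDeriv, shearletExt_smul, Pi.smul_apply]
  rw [fderiv_const_smul (hΦ.differentiableAt p)]
  simp

theorem ShearletSmooth.iterate (v : Plane × ℝ × ℝ) (n : ℕ) {Φ : ShearletGroup → ℂ}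
    (hΦ : ShearletSmooth Φ) : ShearletSmooth ((shearletDeriv v)^[n] Φ) := by
  induction n with
  | zero => exact hΦ
  | succ n ih => rw [Function.iterate_succ_apply']; exact ih.deriv v

theorem shearletDeriv_iterate_add (v : Plane × ℝ × ℝ) (n : ℕ) {Φ Ψ : ShearletGroup → ℂ}
    (hΦ : ShearletSmooth Φ) (hΨ : ShearletSmooth Ψ) :
    (shearletDeriv v)^[n] (Φ + Ψ) = (shearletDeriv v)^[n] Φ + (shearletDeriv v)^[n] Ψ := by
  induction n with
  | zero => rfl
  | succ n ih =>
    simp only [Function.iterate_succ_apply']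
    rw [ih, shearletDeriv_add v (hΦ.iterate v n) (hΨ.iterate v n)]

theorem shearletDeriv_iterate_smul (v : Plane × ℝ × ℝ) (n : ℕ) (c : ℂ)
    {Φ : ShearletGroup → ℂ} (hΦ : ShearletSmooth Φ) :
    (shearletDeriv v)^[n] (c • Φ) = c • (shearletDeriv v)^[n] Φ := by
  induction n with
  | zero => rfl
  | succ n ih =>
    simp only [Function.iterate_succ_apply']
    rw [ih, shearletDeriv_smul v c (hΦ.iterate v n)]

theorem shearletPartial_add (i : ShearletIndex) {Φ Ψ : ShearletGroup → ℂ}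
    (hΦ : ShearletSmooth Φ) (hΨ : ShearletSmooth Ψ) :
    shearletPartial i (Φ + Ψ) = shearletPartial i Φ + shearletPartial i Ψ := by
  unfold shearletPartial
  rw [shearletDeriv_iterate_add _ _ hΦ hΨ,
    shearletDeriv_iterate_add _ _ (hΦ.iterate _ _) (hΨ.iterate _ _),
    shearletDeriv_iterate_add _ _ ((hΦ.iterate _ _).iterate _ _) ((hΨ.iterate _ _).iterate _ _),
    shearletDeriv_iterate_add _ _ (((hΦ.iterate _ _).iterate _ _).iterate _ _)
      (((hΨ.iterate _ _).iterate _ _).iterate _ _)]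

theorem shearletPartial_smul (i : ShearletIndex) (c : ℂ) {Φ : ShearletGroup → ℂ}
    (hΦ : ShearletSmooth Φ) : shearletPartial i (c • Φ) = c • shearletPartial i Φ := by
  unfold shearletPartial
  rw [shearletDeriv_iterate_smul _ _ c hΦ,
    shearletDeriv_iterate_smul _ _ c (hΦ.iterate _ _),
    shearletDeriv_iterate_smul _ _ c ((hΦ.iterate _ _).iterate _ _),
    shearletDeriv_iterate_smul _ _ c (((hΦ.iterate _ _).iterate _ _).iterate _ _)]

theorem shearletPartial_zero (i : ShearletIndex) : shearletPartial i 0 = 0 := by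
  simpa using shearletPartial_smul i 0 ShearletSmooth.zero

/-- The quantity whose supremum over the shearlet group is the norm with index `i`. -/
def shearletBound (i : ShearletIndex) (Φ : ShearletGroup → ℂ) (p : ShearletGroup) : ℝ :=
  shearletWeight i p * ‖shearletPartial i Φ p‖

theorem shearletBound_add_le (i : ShearletIndex) {Φ Ψ : ShearletGroup → ℂ}
    (hΦ : ShearletSmooth Φ) (hΨ : ShearletSmooth Ψ) (p : ShearletGroup) :
    shearletBound i (Φ + Ψ) p ≤ shearletBound i Φ p + shearletBound i Ψ p := by
  unfold shearletBound
  rw [shearletPartial_add i hΦ hΨ, ← mul_add]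
  exact mul_le_mul_of_nonneg_left (norm_add_le _ _) (shearletWeight_nonneg i p)

theorem shearletBound_smul (i : ShearletIndex) (c : ℂ) {Φ : ShearletGroup → ℂ}
    (hΦ : ShearletSmooth Φ) (p : ShearletGroup) :
    shearletBound i (c • Φ) p = ‖c‖ * shearletBound i Φ p := by
  unfold shearletBound
  rw [shearletPartial_smul i c hΦ, Pi.smul_apply, norm_smul]
  ring

theorem shearletBound_nonneg (i : ShearletIndex) (Φ : ShearletGroup → ℂ) (p : ShearletGroup) :
    0 ≤ shearletBound i Φ p :=
  mul_nonneg (shearletWeight_nonneg i p) (norm_nonneg _)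

/-- The smooth functions on the shearlet group all of whose norms are finite. -/
def shearletSchwartzSubmodule : Submodule ℂ (ShearletGroup → ℂ) where
  carrier := {Φ | ShearletSmooth Φ ∧ ∀ i, BddAbove (Set.range (shearletBound i Φ))}
  zero_mem' := by
    refine ⟨ShearletSmooth.zero, fun i => ⟨0, ?_⟩⟩
    rintro _ ⟨p, rfl⟩
    simp [shearletBound, shearletPartial_zero]
  add_mem' := by
    rintro Φ Ψ ⟨hΦ, hΦb⟩ ⟨hΨ, hΨb⟩
    refine ⟨hΦ.add hΨ, fun i => ?_⟩
    obtain ⟨A, hA⟩ := hΦb i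
    obtain ⟨B, hB⟩ := hΨb i
    refine ⟨A + B, ?_⟩
    rintro _ ⟨p, rfl⟩
    exact (shearletBound_add_le i hΦ hΨ p).trans (add_le_add (hA ⟨p, rfl⟩) (hB ⟨p, rfl⟩))
  smul_mem' := by
    rintro c Φ ⟨hΦ, hΦb⟩
    refine ⟨hΦ.smul c, fun i => ?_⟩
    obtain ⟨A, hA⟩ := hΦb i
    refine ⟨‖c‖ * A, ?_⟩
    rintro _ ⟨p, rfl⟩
    rw [shearletBound_smul i c hΦ]
    exact mul_le_mul_of_nonneg_left (hA ⟨p, rfl⟩) (norm_nonneg c)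

/-- The space `S(𝕊)` of highly localized functions on the shearlet group. It is a type of its own,
so that it carries only the topology of the norms below and not that of pointwise convergence. -/
def ShearletSchwartz : Type := shearletSchwartzSubmodule

namespace ShearletSchwartz

instance : AddCommGroup ShearletSchwartz := inferInstanceAs (AddCommGroup shearletSchwartzSubmodule)

instance : Module ℂ ShearletSchwartz := inferInstanceAs (Module ℂ shearletSchwartzSubmodule)

/-- The underlying function on the shearlet group. -/
def toFun (Φ : ShearletSchwartz) : ShearletGroup → ℂ :=
  (show shearletSchwartzSubmodule from Φ).1

instance : CoeFun ShearletSchwartz fun _ => ShearletGroup → ℂ := ⟨toFun⟩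

theorem smooth (Φ : ShearletSchwartz) : ShearletSmooth Φ :=
  (show shearletSchwartzSubmodule from Φ).2.1

theorem bddAbove (Φ : ShearletSchwartz) (i : ShearletIndex) :
    BddAbove (Set.range (shearletBound i Φ)) :=
  (show shearletSchwartzSubmodule from Φ).2.2 i

theorem toFun_add (Φ Ψ : ShearletSchwartz) : toFun (Φ + Ψ) = toFun Φ + toFun Ψ := rfl

theorem toFun_smul (c : ℂ) (Φ : ShearletSchwartz) : toFun (c • Φ) = c • toFun Φ := rfl

theorem toFun_zero : toFun 0 = 0 := rfl

/-- The norm `p_{k₁,k₂,l,m}^{α₁,α₂,β,γ}`. -/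
def seminorm (i : ShearletIndex) : Seminorm ℂ ShearletSchwartz :=
  Seminorm.ofSMulLE (fun Φ => ⨆ p, shearletBound i Φ p)
    (by simp [toFun_zero, shearletBound, shearletPartial_zero])
    (fun Φ Ψ => by
      have : Nonempty ShearletGroup := ⟨(0, 0, ⟨1, one_ne_zero⟩)⟩
      refine ciSup_le fun p => ?_
      rw [toFun_add]
      exact (shearletBound_add_le i Φ.smooth Ψ.smooth p).trans
        (add_le_add (le_ciSup (Φ.bddAbove i) p) (le_ciSup (Ψ.bddAbove i) p)))
    (fun c Φ => by
      have : Nonempty ShearletGroup := ⟨(0, 0, ⟨1, one_ne_zero⟩)⟩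
      refine ciSup_le fun p => ?_
      rw [toFun_smul, shearletBound_smul i c Φ.smooth]
      exact mul_le_mul_of_nonneg_left (le_ciSup (Φ.bddAbove i) p) (norm_nonneg c))

/-- The family of all the norms. -/
def seminormFamily : SeminormFamily ℂ ShearletSchwartz ShearletIndex := seminorm

/-- The locally convex topology of `S(𝕊)`, defined by the norms. -/
instance : TopologicalSpace ShearletSchwartz := seminormFamily.moduleFilterBasis.topology

theorem withSeminorms : WithSeminorms seminormFamily := ⟨rfl⟩

end ShearletSchwartz

end

/-! Everything rests on one pointwise estimate of the kernel `F p * shearletRep p ψ x`. Let u =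
`shearletSize p`, where p = (b, s, a). The matrix A_a⁻¹N_s⁻¹, its inverse, the point b and the
factor |a|^{-3/4} are all bounded by a constant times u. Hence each x-derivative of the kernel, and
each weight 1 + ‖x‖, costs at most one power of u, while F decays faster than every power of u.
Since u^{-5} is integrable for the Haar measure, the kernel with all its derivatives and weights is
dominated by a seminorm of F times a seminorm of ψ times u^{-5}
(`one_add_norm_pow_mul_iteratedFDeriv_synthesisKernel_le`). All derivatives fall on ψ, so only the
undifferentiated norms of F enter.

This estimate gives absolute convergence, differentiation under the integral
(`hasFTaylorSeriesUpTo_integral_of_dominated`), the Schwartz bounds and the bilinear seminorm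
inequality behind joint continuity. Moments vanish by Fubini: for fixed p the kernel is a multiple
of an affine image of ψ, and an affine change of variables turns monomials into polynomials, to
which ψ is orthogonal. -/

/-! ### Smoothness of parametric integrals -/

/-- Differentiation under the integral sign to all orders: if the iterated derivatives of the
smooth functions `Θ a` are dominated, uniformly in the space variable, by integrable functions
of the parameter `a`, then the integral `∫ Θ a dμ(a)` is smooth and its Taylor series is the
integral of the Taylor series of the `Θ a`. -/
theorem hasFTaylorSeriesUpTo_integral_of_dominated {α E V : Type*} [MeasurableSpace α]
    {μ : Measure α} [NormedAddCommGroup E] [NormedSpace ℝ E] [NormedAddCommGroup V]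
    [NormedSpace ℝ V] {Θ : α → E → V} (hΘ : ∀ a, ContDiff ℝ ∞ (Θ a))
    (hmeas : ∀ n x, AEStronglyMeasurable (fun a => iteratedFDeriv ℝ n (Θ a) x) μ)
    {bound : ℕ → α → ℝ} (hint : ∀ n, Integrable (bound n) μ)
    (hbound : ∀ n a x, ‖iteratedFDeriv ℝ n (Θ a) x‖ ≤ bound n a) :
    HasFTaylorSeriesUpTo ∞ (fun x => ∫ a, Θ a x ∂μ)
      (fun x n => ∫ a, iteratedFDeriv ℝ n (Θ a) x ∂μ) := by
  have hI : ∀ n x, Integrable (fun a => iteratedFDeriv ℝ n (Θ a) x) μ := fun n x =>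
    (hint n).mono' (hmeas n x) (Filter.Eventually.of_forall fun a => hbound n a x)
  have hD : ∀ (n : ℕ) (x : E), HasFDerivAt (fun y => ∫ a, iteratedFDeriv ℝ n (Θ a) y ∂μ)
      (∫ a, iteratedFDeriv ℝ (n + 1) (Θ a) x ∂μ).curryLeft x := by
    intro n x
    -- The derivative of the n-th derivative is the curried (n+1)-st one. Currying is a linear
    -- isometry, so it commutes with the integral.
    let C := continuousMultilinearCurryLeftEquiv ℝ (fun _ : Fin (n + 1) => E) V
    have hC : (∫ a, iteratedFDeriv ℝ (n + 1) (Θ a) x ∂μ).curryLeft =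
        ∫ a, fderiv ℝ (iteratedFDeriv ℝ n (Θ a)) x ∂μ := by
      have h := ContinuousLinearEquiv.integral_comp_comm (𝕜 := ℝ) (E := E [×(n + 1)]→L[ℝ] V)
        (F := E →L[ℝ] E [×n]→L[ℝ] V) C.toContinuousLinearEquiv
        (fun a => iteratedFDeriv ℝ (n + 1) (Θ a) x) (μ := μ)
      refine Eq.trans h.symm (integral_congr_ae (Filter.Eventually.of_forall fun a => ?_))
      change C (iteratedFDeriv ℝ (n + 1) (Θ a) x) = _
      rw [iteratedFDeriv_succ_eq_comp_left]
      exact C.apply_symm_apply _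
    rw [hC]
    refine hasFDerivAt_integral_of_dominated_of_fderiv_le (s := Set.univ)
      (F' := fun y a => fderiv ℝ (iteratedFDeriv ℝ n (Θ a)) y)
      (bound := bound (n + 1)) Filter.univ_mem (Filter.Eventually.of_forall fun y => hmeas n y)
      (hI n x) ?_ ?_ (hint (n + 1)) ?_
    · have h := C.continuous.comp_aestronglyMeasurable (hmeas (n + 1) x)
      refine h.congr (Filter.Eventually.of_forall fun a => ?_)
      change C (iteratedFDeriv ℝ (n + 1) (Θ a) x) = _
      rw [iteratedFDeriv_succ_eq_comp_left]
      exact C.apply_symm_apply _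
    · refine Filter.Eventually.of_forall fun a y _ => ?_
      rw [norm_fderiv_iteratedFDeriv]
      exact hbound (n + 1) a y
    · refine Filter.Eventually.of_forall fun a y _ => ?_
      exact ((hΘ a).differentiable_iteratedFDeriv (m := n)
        (mod_cast WithTop.coe_lt_top _) y).hasFDerivAt
  refine ⟨fun x => ?_, fun n _ x => hD n x, fun n _ =>
    continuous_iff_continuousAt.2 fun x => (hD n x).continuousAt⟩
  have h := (continuousMultilinearCurryFin0 ℝ E V).toContinuousLinearEquiv.integral_comp_comm
        (fun a => iteratedFDeriv ℝ 0 (Θ a) x) (μ := μ)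
  exact h.symm

/-! ### Moments against polynomials -/

/-- A function in the Lizorkin space is orthogonal to all polynomials. -/
theorem integral_mvPolynomial_mul_lizorkin {d : ℕ} (P : MvPolynomial (Fin d) ℝ)
    (φ : lizorkinSpace d) :
    ∫ x : EuclideanSpace ℝ (Fin d),
      ((MvPolynomial.eval x P : ℝ) : ℂ) * (φ : 𝓢(EuclideanSpace ℝ (Fin d), ℂ)) x = 0 := by
  simp only [MvPolynomial.eval_eq', Complex.ofReal_sum, Finset.sum_mul, Complex.ofReal_mul,
    mul_assoc]
  rw [integral_finsetSum P.support fun m _ =>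
    (integrable_monomial_mul_schwartz m (φ : 𝓢(EuclideanSpace ℝ (Fin d), ℂ))).const_mul
      ((MvPolynomial.coeff m P : ℝ) : ℂ)]
  refine Finset.sum_eq_zero fun m _ => ?_
  rw [integral_const_mul, φ.2 m, mul_zero]

/-- The moments of an affine image of a function in the Lizorkin space vanish. -/
theorem integral_monomial_mul_lizorkin_comp_affine {d : ℕ} (m : Fin d → ℕ)
    (M N : Matrix (Fin d) (Fin d) ℝ) (hNM : N * M = 1) (b : EuclideanSpace ℝ (Fin d))
    (φ : lizorkinSpace d) :
    ∫ x : EuclideanSpace ℝ (Fin d), ((∏ i, x i ^ m i : ℝ) : ℂ) *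
      (φ : 𝓢(EuclideanSpace ℝ (Fin d), ℂ)) (Matrix.toEuclideanLin M (x - b)) = 0 := by
  -- With y = M (x - b) one has x = N y + b; `P` is the monomial x^m written as a polynomial in y.
  let P : MvPolynomial (Fin d) ℝ :=
    ∏ i, ((∑ j, MvPolynomial.C (N i j) * MvPolynomial.X j) + MvPolynomial.C (b i)) ^ m i
  have hP : ∀ x : EuclideanSpace ℝ (Fin d),
      MvPolynomial.eval (Matrix.toEuclideanLin M (x - b)) P = ∏ i, x i ^ m i := by
    intro x
    have hN : ∀ i, ∑ j, N i j * (Matrix.toEuclideanLin M (x - b)) j = x i - b i := by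
      intro i
      have : N.mulVec (M.mulVec (x - b).ofLp) = (x - b).ofLp := by
        rw [Matrix.mulVec_mulVec, hNM, Matrix.one_mulVec]
      exact congrFun this i
    simp only [P, map_prod, map_pow, map_add, map_sum, map_mul, MvPolynomial.eval_C,
      MvPolynomial.eval_X, hN, sub_add_cancel]
  let g : EuclideanSpace ℝ (Fin d) → ℂ := fun y =>
    ((MvPolynomial.eval y P : ℝ) : ℂ) * (φ : 𝓢(EuclideanSpace ℝ (Fin d), ℂ)) y
  have hdet : LinearMap.det (Matrix.toEuclideanLin M) ≠ 0 := by
    have h1 : Matrix.toEuclideanLin N ∘ₗ Matrix.toEuclideanLin M = LinearMap.id := by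
      ext x i
      have : N.mulVec (M.mulVec x.ofLp) = x.ofLp := by
        rw [Matrix.mulVec_mulVec, hNM, Matrix.one_mulVec]
      exact congrFun this i
    intro h0
    have := congrArg LinearMap.det h1
    rw [LinearMap.det_comp, h0, mul_zero, LinearMap.det_id] at this
    exact zero_ne_one this
  have hg : ∫ x, g (Matrix.toEuclideanLin M x) = 0 := by
    let e := (LinearMap.equivOfDetNeZero _ hdet).toContinuousLinearEquiv
    have h := e.toHomeomorph.measurableEmbedding.integral_map (μ := volume) g
    have h2 : Measure.map e.toHomeomorph (volume : Measure (EuclideanSpace ℝ (Fin d))) =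
      Measure.map (Matrix.toEuclideanLin M) volume := rfl
    -- An invertible linear map only rescales Lebesgue measure, and the scalar is irrelevant because
    -- the integral is zero.
    rw [h2, Measure.map_linearMap_addHaar_eq_smul_addHaar _ hdet, integral_smul_measure,
      integral_mvPolynomial_mul_lizorkin, smul_zero] at h
    exact h.symm
  rw [← integral_sub_right_eq_self _ b] at hg
  rw [← hg]
  refine integral_congr_ae (Filter.Eventually.of_forall fun x => ?_)
  simp only [g, hP]

/-! ### The affine action of the shearlet group on the plane -/

/-- The matrix `N_s A_a`. -/
noncomputable def shearletMatrix (s a : ℝ) : Matrix (Fin 2) (Fin 2) ℝ :=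
  !![a, -(s * (a * |a| ^ (-(1 / 2) : ℝ))); 0, a * |a| ^ (-(1 / 2) : ℝ)]

/-- The matrix `A_a⁻¹ N_s⁻¹`. -/
noncomputable def shearletMatrixInv (s a : ℝ) : Matrix (Fin 2) (Fin 2) ℝ :=
  !![a⁻¹, a⁻¹ * s; 0, a⁻¹ * |a| ^ (1 / 2 : ℝ)]

theorem abs_rpow_half_mul_abs_rpow_neg_half {a : ℝ} (ha : a ≠ 0) :
    |a| ^ (1 / 2 : ℝ) * |a| ^ (-(1 / 2) : ℝ) = 1 := by
  rw [← Real.rpow_add (abs_pos.2 ha)]; simp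

theorem shearMatrix_mul_dilationMatrix (s a : ℝ) :
    shearMatrix s * dilationMatrix a = shearletMatrix s a := by
  ext i j
  fin_cases i <;> fin_cases j <;>
    simp [shearMatrix, dilationMatrix, shearletMatrix, Matrix.mul_apply, Fin.sum_univ_two]

theorem shearletMatrixInv_mul_shearletMatrix (s : ℝ) {a : ℝ} (ha : a ≠ 0) :
    shearletMatrixInv s a * shearletMatrix s a = 1 := by
  have h := abs_rpow_half_mul_abs_rpow_neg_half ha
  ext i j
  fin_cases i <;> fin_cases j <;>
    simp only [shearletMatrixInv, shearletMatrix, Matrix.mul_apply, Fin.sum_univ_two]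
  · simp [ha]
  · simp; ring
  · simp
  · simp only [Fin.mk_one, Matrix.of_apply, Matrix.cons_val', Matrix.cons_val_zero,
      Matrix.cons_val_one, Matrix.cons_val_fin_one, Matrix.one_apply_eq]
    calc _ = (a⁻¹ * a) * (|a| ^ (1 / 2 : ℝ) * |a| ^ (-(1 / 2) : ℝ)) := by ring
      _ = 1 := by rw [h, inv_mul_cancel₀ ha, one_mul]

theorem shearletMatrix_mul_shearletMatrixInv (s : ℝ) {a : ℝ} (ha : a ≠ 0) :
    shearletMatrix s a * shearletMatrixInv s a = 1 :=
  mul_eq_one_comm.1 (shearletMatrixInv_mul_shearletMatrix s ha)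

/-- Replaces abstract matrix inverses by explicit entries, from which continuity in p and the norm
bounds are read off. -/
theorem dilationMatrix_inv_mul_shearMatrix_inv (s : ℝ) {a : ℝ} (ha : a ≠ 0) :
    (dilationMatrix a)⁻¹ * (shearMatrix s)⁻¹ = shearletMatrixInv s a := by
  rw [← Matrix.mul_inv_rev, shearMatrix_mul_dilationMatrix]
  exact Matrix.inv_eq_left_inv (shearletMatrixInv_mul_shearletMatrix s ha)

/-- The linear part `A_a⁻¹ N_s⁻¹` of the action, as a continuous linear map. -/
noncomputable def shearletCLM (p : ShearletGroup) : Plane →L[ℝ] Plane :=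
  LinearMap.toContinuousLinearMap (Matrix.toEuclideanLin (shearletMatrixInv p.2.1 p.2.2))

theorem shearletRep_eq (p : ShearletGroup) (f : Plane → ℂ) (x : Plane) :
    shearletRep p f x =
      ((|(p.2.2 : ℝ)| ^ (-(3 / 4) : ℝ) : ℝ) : ℂ) * f (shearletCLM p (x - p.1)) := by
  rw [shearletRep, dilationMatrix_inv_mul_shearMatrix_inv _ p.2.2.2]
  rfl

theorem continuous_shearletCLM : Continuous shearletCLM := by
  have h1 : Continuous fun p : ShearletGroup => shearletMatrixInv p.2.1 p.2.2 := by
    have h0 : ∀ p : ShearletGroup, (p.2.2 : ℝ) ≠ 0 := fun p => p.2.2.2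
    have h2 : ∀ p : ShearletGroup, |(p.2.2 : ℝ)| ≠ 0 := fun p => abs_ne_zero.2 p.2.2.2
    refine continuous_matrix fun i j => ?_
    have hr : Continuous fun p : ShearletGroup => |(p.2.2 : ℝ)| ^ (1 / 2 : ℝ) :=
      Continuous.rpow_const (by fun_prop) fun p => Or.inl (h2 p)
    have hi : Continuous fun p : ShearletGroup => (p.2.2 : ℝ)⁻¹ :=
      Continuous.inv₀ (by fun_prop) h0
    fin_cases i <;> fin_cases j
    · exact hi
    · exact hi.mul (by fun_prop)
    · exact continuous_const
    · exact hi.mul hr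
  -- The passage from matrices to operators is linear between finite-dimensional spaces, hence
  -- continuous.
  let T : Matrix (Fin 2) (Fin 2) ℝ →ₗ[ℝ] (Plane →L[ℝ] Plane) :=
    LinearMap.toContinuousLinearMap.toLinearMap ∘ₗ Matrix.toEuclideanLin.toLinearMap
  exact T.continuous_of_finiteDimensional.comp h1

/-! ### The size function of the shearlet group -/

/-- `⟨b₁⟩ ⟨b₂⟩ ⟨s⟩ (|a| + 1/|a|)`. -/
noncomputable def shearletSize (p : ShearletGroup) : ℝ :=
  √(1 + p.1 0 ^ 2) * √(1 + p.1 1 ^ 2) * √(1 + p.2.1 ^ 2) *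
    (|(p.2.2 : ℝ)| + |(p.2.2 : ℝ)|⁻¹)

theorem one_le_sqrt_one_add_sq (t : ℝ) : 1 ≤ √(1 + t ^ 2) :=
  Real.one_le_sqrt.2 (by nlinarith [sq_nonneg t])

theorem abs_le_sqrt_one_add_sq (t : ℝ) : |t| ≤ √(1 + t ^ 2) :=
  Real.abs_le_sqrt (by linarith)

theorem one_le_add_inv {t : ℝ} (ht : 0 < t) : 1 ≤ t + t⁻¹ := by
  rcases le_total 1 t with h | h
  · linarith [inv_pos.2 ht]
  · linarith [(one_le_inv₀ ht).2 h]

theorem rpow_le_add_inv {t r : ℝ} (ht : 0 < t) (h₁ : -1 ≤ r) (h₂ : r ≤ 1) :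
    t ^ r ≤ t + t⁻¹ := by
  rcases le_total 1 t with h | h
  · calc t ^ r ≤ t ^ (1 : ℝ) := Real.rpow_le_rpow_of_exponent_le h h₂
      _ ≤ _ := by rw [Real.rpow_one]; linarith [inv_pos.2 ht]
  · calc t ^ r ≤ t ^ (-1 : ℝ) := Real.rpow_le_rpow_of_exponent_ge ht h h₁
      _ ≤ _ := by rw [Real.rpow_neg_one]; linarith

/-- Each factor of the size is at least 1, so any quantity is bounded by comparing it factor by
factor, with 1 in the unused places. -/
theorem mul_le_shearletSize (p : ShearletGroup) {u v w z : ℝ} (hv : 0 ≤ v) (hw : 0 ≤ w)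
    (hz : 0 ≤ z) (hu' : u ≤ √(1 + p.1 0 ^ 2)) (hv' : v ≤ √(1 + p.1 1 ^ 2))
    (hw' : w ≤ √(1 + p.2.1 ^ 2)) (hz' : z ≤ |(p.2.2 : ℝ)| + |(p.2.2 : ℝ)|⁻¹) :
    u * v * w * z ≤ shearletSize p := by
  unfold shearletSize
  gcongr

theorem le_shearletSize_of_le_add_inv (p : ShearletGroup) {z : ℝ} (hz : 0 ≤ z)
    (hz' : z ≤ |(p.2.2 : ℝ)| + |(p.2.2 : ℝ)|⁻¹) : z ≤ shearletSize p := by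
  simpa using mul_le_shearletSize p zero_le_one zero_le_one hz (one_le_sqrt_one_add_sq _)
    (one_le_sqrt_one_add_sq _) (one_le_sqrt_one_add_sq _) hz'

theorem one_le_shearletSize (p : ShearletGroup) : 1 ≤ shearletSize p :=
  le_shearletSize_of_le_add_inv p zero_le_one (one_le_add_inv (abs_pos.2 p.2.2.2))

theorem shearletSize_pos (p : ShearletGroup) : 0 < shearletSize p :=
  zero_lt_one.trans_le (one_le_shearletSize p)

theorem rpow_le_shearletSize (p : ShearletGroup) {r : ℝ} (h₁ : -1 ≤ r) (h₂ : r ≤ 1) :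
    |(p.2.2 : ℝ)| ^ r ≤ shearletSize p :=
  le_shearletSize_of_le_add_inv p (by positivity)
    (rpow_le_add_inv (abs_pos.2 p.2.2.2) h₁ h₂)

theorem abs_mul_rpow_le_shearletSize (p : ShearletGroup) {r : ℝ} (h₁ : -1 ≤ r) (h₂ : r ≤ 1) :
    |p.2.1| * |(p.2.2 : ℝ)| ^ r ≤ shearletSize p := by
  simpa using mul_le_shearletSize p zero_le_one (abs_nonneg _) (by positivity)
    (one_le_sqrt_one_add_sq _) (one_le_sqrt_one_add_sq _) (abs_le_sqrt_one_add_sq _)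
    (rpow_le_add_inv (abs_pos.2 p.2.2.2) h₁ h₂)

theorem norm_plane_le (x : Plane) : ‖x‖ ≤ |x 0| + |x 1| := by
  rw [EuclideanSpace.norm_eq, Fin.sum_univ_two]
  refine Real.sqrt_le_iff.2 ⟨by positivity, ?_⟩
  simp only [Real.norm_eq_abs]
  nlinarith [mul_nonneg (abs_nonneg (x 0)) (abs_nonneg (x 1))]

theorem norm_fst_le_shearletSize (p : ShearletGroup) : ‖p.1‖ ≤ 2 * shearletSize p := by
  have ha := one_le_add_inv (abs_pos.2 p.2.2.2)
  have h0 : |p.1 0| ≤ shearletSize p := by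
    simpa using mul_le_shearletSize p zero_le_one zero_le_one zero_le_one
      (abs_le_sqrt_one_add_sq _) (one_le_sqrt_one_add_sq _) (one_le_sqrt_one_add_sq _) ha
  have h1 : |p.1 1| ≤ shearletSize p := by
    simpa using mul_le_shearletSize p (abs_nonneg _) zero_le_one zero_le_one
      (one_le_sqrt_one_add_sq _) (abs_le_sqrt_one_add_sq _) (one_le_sqrt_one_add_sq _) ha
  linarith [norm_plane_le p.1]

/-- The factor 3 counts the entries of the triangular matrix that may be nonzero; each contributes
at most C‖x‖. -/
theorem norm_toEuclideanLin_le (u v w C : ℝ) (hu : |u| ≤ C) (hv : |v| ≤ C) (hw : |w| ≤ C)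
    (x : Plane) : ‖Matrix.toEuclideanLin !![u, v; 0, w] x‖ ≤ 3 * C * ‖x‖ := by
  have h0 : (Matrix.toEuclideanLin !![u, v; 0, w] x) 0 = u * x 0 + v * x 1 := by
    simp [Matrix.toLpLin_apply, dotProduct, Fin.sum_univ_two]
  have h1 : (Matrix.toEuclideanLin !![u, v; 0, w] x) 1 = w * x 1 := by
    simp [Matrix.toLpLin_apply, dotProduct, Fin.sum_univ_two]
  have hx : ∀ i, |x i| ≤ ‖x‖ := fun i => by simpa using PiLp.norm_apply_le x i
  have hC : 0 ≤ C := (abs_nonneg u).trans hu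
  have hm : ∀ c i, |c| ≤ C → |c * x i| ≤ C * ‖x‖ := fun c i hc => by
    rw [abs_mul]; exact mul_le_mul hc (hx i) (abs_nonneg _) hC
  refine (norm_plane_le _).trans ?_
  rw [h0, h1]
  linarith [abs_add_le (u * x 0) (v * x 1), hm u 0 hu, hm v 1 hv, hm w 1 hw]

theorem norm_shearletCLM_le (p : ShearletGroup) : ‖shearletCLM p‖ ≤ 3 * shearletSize p := by
  have ha : 0 < |(p.2.2 : ℝ)| := abs_pos.2 p.2.2.2
  refine ContinuousLinearMap.opNorm_le_bound _ (by linarith [shearletSize_pos p]) fun x => ?_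
  refine norm_toEuclideanLin_le _ _ _ _ ?_ ?_ ?_ x
  · rw [abs_inv, ← Real.rpow_neg_one]
    exact rpow_le_shearletSize p le_rfl (by norm_num)
  · rw [abs_mul, abs_inv, ← Real.rpow_neg_one, mul_comm]
    exact abs_mul_rpow_le_shearletSize p le_rfl (by norm_num)
  · rw [abs_mul, abs_inv, ← Real.rpow_neg_one, abs_of_nonneg (by positivity :
      0 ≤ |(p.2.2 : ℝ)| ^ (1 / 2 : ℝ)), ← Real.rpow_add ha]
    exact rpow_le_shearletSize p (by norm_num) (by norm_num)

/-- The inverse N_s A_a has entries of modulus |a|, |s||a|^{1/2}, |a|^{1/2}, all with exponents in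
[-1, 1], so it obeys the same bound as A_a⁻¹N_s⁻¹. -/
theorem norm_le_shearletCLM (p : ShearletGroup) (y : Plane) :
    ‖y‖ ≤ 3 * shearletSize p * ‖shearletCLM p y‖ := by
  have ha : 0 < |(p.2.2 : ℝ)| := abs_pos.2 p.2.2.2
  have hy : y = Matrix.toEuclideanLin (shearletMatrix p.2.1 p.2.2) (shearletCLM p y) := by
    ext i
    have : (shearletMatrix p.2.1 p.2.2).mulVec
        ((shearletMatrixInv p.2.1 p.2.2).mulVec y.ofLp) = y.ofLp := by
      rw [Matrix.mulVec_mulVec, shearletMatrix_mul_shearletMatrixInv _ p.2.2.2,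
        Matrix.one_mulVec]
    exact (congrFun this i).symm
  have hd : |(p.2.2 : ℝ) * |(p.2.2 : ℝ)| ^ (-(1 / 2) : ℝ)| = |(p.2.2 : ℝ)| ^ (1 / 2 : ℝ) := by
    rw [abs_mul, abs_of_nonneg (by positivity : 0 ≤ |(p.2.2 : ℝ)| ^ (-(1 / 2) : ℝ))]
    nth_rewrite 1 [← Real.rpow_one |(p.2.2 : ℝ)|]
    rw [← Real.rpow_add ha]
    norm_num
  conv_lhs => rw [hy]
  refine norm_toEuclideanLin_le _ _ _ _ ?_ ?_ ?_ _
  · rw [← Real.rpow_one |(p.2.2 : ℝ)|]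
    exact rpow_le_shearletSize p (by norm_num) le_rfl
  · rw [abs_neg, abs_mul, hd]
    exact abs_mul_rpow_le_shearletSize p (by norm_num) (by norm_num)
  · rw [hd]
    exact rpow_le_shearletSize p (by norm_num) (by norm_num)

/-- Converts decay of ψ at the transformed point into decay in x, at the price of one power of the
size. The three terms 1 ≤ u, ‖b‖ ≤ 2u and ‖x - b‖ ≤ 3u‖y‖, with y the transformed point, add up to
the right-hand side. -/
theorem one_add_norm_le_shearletCLM (p : ShearletGroup) (x : Plane) :
    1 + ‖x‖ ≤ 3 * shearletSize p * (1 + ‖shearletCLM p (x - p.1)‖) := by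
  have h := norm_le_shearletCLM p (x - p.1)
  have h2 : ‖x‖ ≤ ‖x - p.1‖ + ‖p.1‖ := by simpa using norm_add_le (x - p.1) p.1
  linarith [norm_fst_le_shearletSize p, one_le_shearletSize p]

/-! ### Integrability of negative powers of the size function -/

instance : SigmaFinite lebesgueNeZero := by
  refine SigmaFinite.of_map _ measurable_subtype_coe.aemeasurable ?_
  have hs : MeasurableSet {a : ℝ | a ≠ 0} := (measurableSet_singleton (0 : ℝ)).compl
  have h : Measure.map Subtype.val lebesgueNeZero = _ :=
    (MeasurableEmbedding.subtype_coe hs).map_comap volume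
  rw [h]
  infer_instance

instance : SFinite shearletHaar := by unfold shearletHaar; infer_instance

theorem continuous_shearletSize : Continuous shearletSize := by
  have h : Continuous fun p : ShearletGroup => |(p.2.2 : ℝ)|⁻¹ :=
    Continuous.inv₀ (by fun_prop) fun p => abs_ne_zero.2 p.2.2.2
  unfold shearletSize
  fun_prop

theorem integrable_inv_one_add_sq_prod_plane :
    Integrable fun b : Plane => (1 + b 0 ^ 2)⁻¹ * (1 + b 1 ^ 2)⁻¹ := by
  rw [← (PiLp.volume_preserving_toLp (Fin 2)).integrable_comp_emb
    (MeasurableEquiv.toLp 2 _).measurableEmbedding]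
  have h := Integrable.fintype_prod (𝕜 := ℝ) (ι := Fin 2) (E := ℝ)
    (f := fun _ t => (1 + t ^ 2)⁻¹) (μ := fun _ => volume) fun _ => integrable_inv_one_add_sq
  simp only [Fin.prod_univ_two] at h
  exact h

theorem integrable_inv_one_add_sq_lebesgueNeZero :
    Integrable (fun a : {a : ℝ // a ≠ 0} => (1 + (a : ℝ) ^ 2)⁻¹) lebesgueNeZero :=
  (integrableOn_iff_comap_subtypeVal (measurableSet_singleton (0 : ℝ)).compl).1
    integrable_inv_one_add_sq.integrableOn

/-- The exponent is 5 = 3 + 2: three powers absorb the Haar density |a|^{-3}, and two dominate the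
product of 1 + t² over the four coordinates, using (|a| + |a|⁻¹)² ≥ 1 + a². -/
theorem integrable_inv_shearletSize_pow :
    Integrable (fun p : ShearletGroup => (shearletSize p ^ 5)⁻¹) shearletHaar := by
  unfold shearletHaar
  have hm : Measurable fun p : ShearletGroup => (|(p.2.2 : ℝ)| ^ 3)⁻¹ := by fun_prop
  rw [integrable_withDensity_iff (by fun_prop)
    (Filter.Eventually.of_forall fun p => ENNReal.ofReal_lt_top)]
  have hI := integrable_inv_one_add_sq_prod_plane.mul_prod
    (integrable_inv_one_add_sq.mul_prod integrable_inv_one_add_sq_lebesgueNeZero)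
  refine hI.mono' ?_ (Filter.Eventually.of_forall fun p => ?_)
  · have := continuous_shearletSize.measurable
    exact Measurable.aestronglyMeasurable (by fun_prop)
  · have ha : 0 < |(p.2.2 : ℝ)| := abs_pos.2 p.2.2.2
    have hu := shearletSize_pos p
    rw [ENNReal.toReal_ofReal (by positivity), Real.norm_of_nonneg (by positivity)]
    have h1 : |(p.2.2 : ℝ)|⁻¹ ≤ shearletSize p := by
      rw [← Real.rpow_neg_one]; exact rpow_le_shearletSize p le_rfl (by norm_num)
    have h2 : (1 + p.1 0 ^ 2) * (1 + p.1 1 ^ 2) * ((1 + p.2.1 ^ 2) * (1 + (p.2.2 : ℝ) ^ 2)) ≤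
        shearletSize p ^ 2 := by
      rw [shearletSize, mul_pow, mul_pow, mul_pow, Real.sq_sqrt (by positivity),
        Real.sq_sqrt (by positivity), Real.sq_sqrt (by positivity), ← mul_assoc]
      gcongr
      have : |(p.2.2 : ℝ)| * |(p.2.2 : ℝ)|⁻¹ = 1 := mul_inv_cancel₀ ha.ne'
      nlinarith [sq_abs (p.2.2 : ℝ), sq_nonneg (|(p.2.2 : ℝ)|⁻¹)]
    calc (shearletSize p ^ 5)⁻¹ * (|(p.2.2 : ℝ)| ^ 3)⁻¹
        = (shearletSize p ^ 5)⁻¹ * |(p.2.2 : ℝ)|⁻¹ ^ 3 := by rw [inv_pow]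
      _ ≤ (shearletSize p ^ 5)⁻¹ * shearletSize p ^ 3 := by gcongr
      _ = (shearletSize p ^ 2)⁻¹ := by field_simp
      _ ≤ ((1 + p.1 0 ^ 2) * (1 + p.1 1 ^ 2) *
          ((1 + p.2.1 ^ 2) * (1 + (p.2.2 : ℝ) ^ 2)))⁻¹ := by gcongr
      _ = _ := by simp only [mul_inv]

/-! ### The synthesis kernel -/

/-- The index of the norm controlling decay of order `N` in all variables. -/
def decayIndex (N : ℕ) : ShearletIndex := ⟨N, N, N, N, 0, 0, 0, 0⟩

theorem ShearletSchwartz.continuous_toFun (F : ShearletSchwartz) : Continuous F.toFun := by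
  have h : F.toFun = shearletExt F ∘ shearletIncl := by
    ext p; exact (shearletExt_incl F p).symm
  rw [h]
  refine (ContDiffOn.continuousOn F.smooth).comp_continuous ?_ fun p => p.2.2.2
  unfold shearletIncl
  fun_prop

theorem ShearletSchwartz.norm_apply_le (F : ShearletSchwartz) (N : ℕ) (p : ShearletGroup) :
    ‖F p‖ ≤ 2 ^ N * ShearletSchwartz.seminorm (decayIndex N) F * (shearletSize p ^ N)⁻¹ := by
  have hu := shearletSize_pos p
  have ha : 0 < |(p.2.2 : ℝ)| := abs_pos.2 p.2.2.2
  have h : shearletWeight (decayIndex N) p * ‖F p‖ ≤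
      ShearletSchwartz.seminorm (decayIndex N) F := le_ciSup (F.bddAbove (decayIndex N)) p
  have hw : shearletSize p ^ N ≤ 2 ^ N * shearletWeight (decayIndex N) p := by
    -- The norm carries a sum of powers, the size a power of a sum; convexity gives 2^{N-1},
    -- weakened to 2^N, which also covers N = 0.
    have h2 : (|(p.2.2 : ℝ)| + |(p.2.2 : ℝ)|⁻¹) ^ N ≤
        2 ^ N * (|(p.2.2 : ℝ)| ^ N + 1 / |(p.2.2 : ℝ)| ^ N) := by
      refine (add_pow_le ha.le (inv_pos.2 ha).le N).trans ?_
      rw [inv_pow, one_div]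
      gcongr
      · norm_num
      · exact Nat.sub_le _ _
    calc shearletSize p ^ N
        = √(1 + p.1 0 ^ 2) ^ N * √(1 + p.1 1 ^ 2) ^ N * √(1 + p.2.1 ^ 2) ^ N *
          (|(p.2.2 : ℝ)| + |(p.2.2 : ℝ)|⁻¹) ^ N := by rw [shearletSize, mul_pow, mul_pow, mul_pow]
      _ ≤ √(1 + p.1 0 ^ 2) ^ N * √(1 + p.1 1 ^ 2) ^ N * √(1 + p.2.1 ^ 2) ^ N *
          (2 ^ N * (|(p.2.2 : ℝ)| ^ N + 1 / |(p.2.2 : ℝ)| ^ N)) := by gcongr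
      _ = 2 ^ N * shearletWeight (decayIndex N) p := by
        simp only [shearletWeight, decayIndex]; ring
  rw [← div_eq_mul_inv, le_div_iff₀ (by positivity)]
  calc ‖F p‖ * shearletSize p ^ N ≤ ‖F p‖ * (2 ^ N * shearletWeight (decayIndex N) p) := by gcongr
    _ = 2 ^ N * (shearletWeight (decayIndex N) p * ‖F p‖) := by ring
    _ ≤ _ := by gcongr

/-- The integrand of the synthesis operator. -/
noncomputable def synthesisKernel (F : ShearletSchwartz) (ψ : 𝓢(Plane, ℂ)) (p : ShearletGroup)
    (x : Plane) : ℂ :=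
  F p * shearletRep p ψ x

theorem synthesisKernel_eq (F : ShearletSchwartz) (ψ : 𝓢(Plane, ℂ)) (p : ShearletGroup) :
    synthesisKernel F ψ p = fun x =>
      (F p * ((|(p.2.2 : ℝ)| ^ (-(3 / 4) : ℝ) : ℝ) : ℂ)) • (ψ ∘ shearletCLM p) (x - p.1) := by
  ext x
  simp [synthesisKernel, shearletRep_eq, mul_assoc]

theorem contDiff_synthesisKernel (F : ShearletSchwartz) (ψ : 𝓢(Plane, ℂ)) (p : ShearletGroup) :
    ContDiff ℝ ∞ (synthesisKernel F ψ p) := by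
  rw [synthesisKernel_eq]
  exact (((ψ.smooth _).comp (shearletCLM p).contDiff).comp
    (contDiff_id.sub contDiff_const)).const_smul _

theorem iteratedFDeriv_synthesisKernel (F : ShearletSchwartz) (ψ : 𝓢(Plane, ℂ))
    (p : ShearletGroup) (n : ℕ) (x : Plane) :
    iteratedFDeriv ℝ n (synthesisKernel F ψ p) x =
      (F p * ((|(p.2.2 : ℝ)| ^ (-(3 / 4) : ℝ) : ℝ) : ℂ)) •
        (iteratedFDeriv ℝ n ψ (shearletCLM p (x - p.1))).compContinuousLinearMap
          fun _ => shearletCLM p := by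
  have hg : ContDiff ℝ n (fun y => (ψ ∘ shearletCLM p) (y - p.1)) :=
    ((ψ.smooth _).comp (shearletCLM p).contDiff).comp (contDiff_id.sub contDiff_const)
  rw [synthesisKernel_eq]
  refine (iteratedFDeriv_const_smul_apply (R := ℂ) hg.contDiffAt).trans ?_
  rw [iteratedFDeriv_comp_sub, (shearletCLM p).iteratedFDeriv_comp_right (ψ.smooth n) _ le_rfl]

/-- Joint continuity supplies measurability both on the group, for the parametric integral, and on
the product with the plane, for Fubini. -/
theorem continuous_iteratedFDeriv_synthesisKernel (F : ShearletSchwartz) (ψ : 𝓢(Plane, ℂ))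
    (n : ℕ) : Continuous fun q : ShearletGroup × Plane =>
      iteratedFDeriv ℝ n (synthesisKernel F ψ q.1) q.2 := by
  simp only [iteratedFDeriv_synthesisKernel]
  have h1 := F.continuous_toFun
  have h2 : Continuous fun q : ShearletGroup × Plane => |(q.1.2.2 : ℝ)| ^ (-(3 / 4) : ℝ) :=
    Continuous.rpow_const (by fun_prop) fun q => Or.inl (abs_ne_zero.2 q.1.2.2.2)
  have h3 : Continuous fun q : ShearletGroup × Plane => shearletCLM q.1 :=
    continuous_shearletCLM.comp continuous_fst
  have h4 : Continuous (iteratedFDeriv ℝ n ψ) := (ψ.smooth n).continuous_iteratedFDeriv le_rfl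
  refine Continuous.smul ((h1.comp continuous_fst).mul
    (Complex.continuous_ofReal.comp h2)) ?_
  -- Precomposition of a multilinear map with linear maps is itself continuous multilinear in those
  -- linear maps.
  have h5 : Continuous fun q : ShearletGroup × Plane =>
      ContinuousMultilinearMap.compContinuousLinearMapContinuousMultilinear ℝ
        (fun _ : Fin n => Plane) (fun _ => Plane) ℂ (fun _ => shearletCLM q.1) :=
    (ContinuousMultilinearMap.cont _).comp (continuous_pi fun _ => h3)
  exact h5.clm_apply (h4.comp (h3.clm_apply (by fun_prop)))

theorem continuous_synthesisKernel (F : ShearletSchwartz) (ψ : 𝓢(Plane, ℂ)) :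
    Continuous fun q : ShearletGroup × Plane => synthesisKernel F ψ q.1 q.2 :=
  (continuousMultilinearCurryFin0 ℝ Plane ℂ).continuous.comp
    (continuous_iteratedFDeriv_synthesisKernel F ψ 0)

/-- The constant in the estimate of the derivatives of the kernel of order `n`, with weight
`(1 + ‖x‖) ^ k`. -/
noncomputable def kernelConst (k n : ℕ) (F : ShearletSchwartz) (ψ : 𝓢(Plane, ℂ)) : ℝ :=
  2 ^ (k + n + 6) * 3 ^ (k + n) * 2 ^ k * ShearletSchwartz.seminorm (decayIndex (k + n + 6)) F *
    ((Finset.Iic (k, n)).sup fun m => SchwartzMap.seminorm ℂ m.1 m.2) ψ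

/-- The decay order k + n + 6 of F is spent as follows: k powers of the size for the weight in x, n
for the chain rule, one for |a|^{-3/4}, and the remaining 5 for integrability over the group. -/
theorem one_add_norm_pow_mul_iteratedFDeriv_synthesisKernel_le (F : ShearletSchwartz)
    (ψ : 𝓢(Plane, ℂ)) (k n : ℕ) (p : ShearletGroup) (x : Plane) :
    (1 + ‖x‖) ^ k * ‖iteratedFDeriv ℝ n (synthesisKernel F ψ p) x‖ ≤
      kernelConst k n F ψ * (shearletSize p ^ 5)⁻¹ := by
  have hu := shearletSize_pos p
  set u := shearletSize p
  set y := shearletCLM p (x - p.1)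
  have hw : |(p.2.2 : ℝ)| ^ (-(3 / 4) : ℝ) ≤ u :=
    rpow_le_shearletSize p (by norm_num) (by norm_num)
  have hD : ‖iteratedFDeriv ℝ n (synthesisKernel F ψ p) x‖ ≤
      ‖F p‖ * u * (‖iteratedFDeriv ℝ n ψ y‖ * (3 * u) ^ n) := by
    rw [iteratedFDeriv_synthesisKernel, norm_smul, norm_mul, Complex.norm_real,
      Real.norm_of_nonneg (by positivity)]
    gcongr
    refine (ContinuousMultilinearMap.norm_compContinuousLinearMap_le _ _).trans ?_
    rw [Finset.prod_const, Finset.card_univ, Fintype.card_fin]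
    gcongr
    exact norm_shearletCLM_le p
  have hψ := SchwartzMap.one_add_le_sup_seminorm_apply (𝕜 := ℂ) (m := (k, n)) le_rfl le_rfl ψ y
  have hF := F.norm_apply_le (k + n + 6) p
  set Q := ShearletSchwartz.seminorm (decayIndex (k + n + 6)) F with hQ
  set R := ((Finset.Iic (k, n)).sup fun m => SchwartzMap.seminorm ℂ m.1 m.2) ψ with hR
  have hQ0 : 0 ≤ Q := apply_nonneg _ _
  calc (1 + ‖x‖) ^ k * ‖iteratedFDeriv ℝ n (synthesisKernel F ψ p) x‖
      ≤ (3 * u * (1 + ‖y‖)) ^ k * (‖F p‖ * u * (‖iteratedFDeriv ℝ n ψ y‖ * (3 * u) ^ n)) := by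
        gcongr
        exact one_add_norm_le_shearletCLM p x
    _ = ‖F p‖ * u * (3 * u) ^ (k + n) * ((1 + ‖y‖) ^ k * ‖iteratedFDeriv ℝ n ψ y‖) := by
        rw [mul_pow (3 * u), pow_add]; ring
    _ ≤ (2 ^ (k + n + 6) * Q * (u ^ (k + n + 6))⁻¹) * u * (3 * u) ^ (k + n) * (2 ^ k * R) := by
        gcongr
    _ = kernelConst k n F ψ * (u ^ 5)⁻¹ := by
        rw [kernelConst, ← hQ, ← hR, mul_pow, show u ^ (k + n + 6) = u ^ (k + n) * u * u ^ 5 by ring]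
        field_simp

theorem norm_iteratedFDeriv_synthesisKernel_le (F : ShearletSchwartz)
    (ψ : 𝓢(Plane, ℂ)) (n : ℕ) (p : ShearletGroup) (x : Plane) :
    ‖iteratedFDeriv ℝ n (synthesisKernel F ψ p) x‖ ≤
      kernelConst 0 n F ψ * (shearletSize p ^ 5)⁻¹ := by
  simpa using one_add_norm_pow_mul_iteratedFDeriv_synthesisKernel_le F ψ 0 n p x

theorem aestronglyMeasurable_iteratedFDeriv_synthesisKernel (F : ShearletSchwartz)
    (ψ : 𝓢(Plane, ℂ)) (n : ℕ) (x : Plane) :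
    AEStronglyMeasurable (fun p => iteratedFDeriv ℝ n (synthesisKernel F ψ p) x) shearletHaar :=
  ((continuous_iteratedFDeriv_synthesisKernel F ψ n).comp
    (by fun_prop : Continuous fun p : ShearletGroup => (p, x))).aestronglyMeasurable

theorem integrable_synthesisKernel (F : ShearletSchwartz) (ψ : 𝓢(Plane, ℂ)) (x : Plane) :
    Integrable (fun p => synthesisKernel F ψ p x) shearletHaar := by
  refine (integrable_inv_shearletSize_pow.const_mul (kernelConst 0 0 F ψ)).mono' ?_
    (Filter.Eventually.of_forall fun p => ?_)
  · exact ((continuous_synthesisKernel F ψ).comp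
      (by fun_prop : Continuous fun p : ShearletGroup => (p, x))).aestronglyMeasurable
  · simpa using norm_iteratedFDeriv_synthesisKernel_le F ψ 0 p x

/-! ### The synthesis operator on Schwartz functions -/

theorem hasFTaylorSeriesUpTo_shearletSynthesis (F : ShearletSchwartz) (ψ : 𝓢(Plane, ℂ)) :
    HasFTaylorSeriesUpTo ∞ (shearletSynthesis ψ F)
      (fun x n => ∫ p, iteratedFDeriv ℝ n (synthesisKernel F ψ p) x ∂shearletHaar) :=
  hasFTaylorSeriesUpTo_integral_of_dominated (contDiff_synthesisKernel F ψ)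
    (aestronglyMeasurable_iteratedFDeriv_synthesisKernel F ψ)
    (fun n => integrable_inv_shearletSize_pow.const_mul (kernelConst 0 n F ψ))
    (norm_iteratedFDeriv_synthesisKernel_le F ψ)

theorem norm_pow_mul_iteratedFDeriv_shearletSynthesis_le (F : ShearletSchwartz)
    (ψ : 𝓢(Plane, ℂ)) (k n : ℕ) (x : Plane) :
    ‖x‖ ^ k * ‖iteratedFDeriv ℝ n (shearletSynthesis ψ F) x‖ ≤
      kernelConst k n F ψ * ∫ p, (shearletSize p ^ 5)⁻¹ ∂shearletHaar := by
  rw [← (hasFTaylorSeriesUpTo_shearletSynthesis F ψ).eq_iteratedFDeriv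
    (mod_cast le_top) x, ← integral_const_mul]
  -- The weight does not depend on p, so it is divided out before integrating the bound and restored
  -- afterwards.
  have hx : (0 : ℝ) < (1 + ‖x‖) ^ k := by positivity
  have h : ‖∫ p, iteratedFDeriv ℝ n (synthesisKernel F ψ p) x ∂shearletHaar‖ ≤
      ∫ p, ((1 + ‖x‖) ^ k)⁻¹ * (kernelConst k n F ψ * (shearletSize p ^ 5)⁻¹) ∂shearletHaar := by
    refine norm_integral_le_of_norm_le
      ((integrable_inv_shearletSize_pow.const_mul _).const_mul _)
      (Filter.Eventually.of_forall fun p => ?_)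
    rw [← div_eq_inv_mul, le_div_iff₀' hx]
    exact one_add_norm_pow_mul_iteratedFDeriv_synthesisKernel_le F ψ k n p x
  rw [integral_const_mul, ← div_eq_inv_mul, le_div_iff₀' hx] at h
  refine le_trans ?_ h
  gcongr
  linarith

/-- The function `S^t_ψ F` as a Schwartz function. -/
noncomputable def synthesisSchwartz (F : ShearletSchwartz) (ψ : 𝓢(Plane, ℂ)) : 𝓢(Plane, ℂ) where
  toFun := shearletSynthesis ψ F
  smooth' := (hasFTaylorSeriesUpTo_shearletSynthesis F ψ).contDiff
  decay' k n := ⟨_, norm_pow_mul_iteratedFDeriv_shearletSynthesis_le F ψ k n⟩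

theorem synthesisSchwartz_apply (F : ShearletSchwartz) (ψ : 𝓢(Plane, ℂ)) (x : Plane) :
    synthesisSchwartz F ψ x = ∫ p, synthesisKernel F ψ p x ∂shearletHaar := rfl

theorem seminorm_synthesisSchwartz_le (F : ShearletSchwartz) (ψ : 𝓢(Plane, ℂ)) (k n : ℕ) :
    SchwartzMap.seminorm ℂ k n (synthesisSchwartz F ψ) ≤
      kernelConst k n F ψ * ∫ p, (shearletSize p ^ 5)⁻¹ ∂shearletHaar := by
  refine SchwartzMap.seminorm_le_bound ℂ k n _ ?_
    (norm_pow_mul_iteratedFDeriv_shearletSynthesis_le F ψ k n)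
  refine mul_nonneg ?_ (integral_nonneg fun p => ?_)
  · unfold kernelConst; positivity
  · have := shearletSize_pos p
    change 0 ≤ (shearletSize p ^ 5)⁻¹
    positivity

theorem synthesisSchwartz_add_left (F G : ShearletSchwartz) (ψ : 𝓢(Plane, ℂ)) :
    synthesisSchwartz (F + G) ψ = synthesisSchwartz F ψ + synthesisSchwartz G ψ := by
  ext x
  rw [add_apply]
  simp only [synthesisSchwartz_apply]
  rw [← integral_add (integrable_synthesisKernel F ψ x) (integrable_synthesisKernel G ψ x)]
  simp [synthesisKernel, ShearletSchwartz.toFun_add, add_mul]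

theorem synthesisSchwartz_smul_left (c : ℂ) (F : ShearletSchwartz) (ψ : 𝓢(Plane, ℂ)) :
    synthesisSchwartz (c • F) ψ = c • synthesisSchwartz F ψ := by
  ext x
  rw [smul_apply]
  simp only [synthesisSchwartz_apply]
  rw [← integral_smul]
  simp [synthesisKernel, ShearletSchwartz.toFun_smul, mul_assoc]

theorem synthesisSchwartz_add_right (F : ShearletSchwartz) (ψ φ : 𝓢(Plane, ℂ)) :
    synthesisSchwartz F (ψ + φ) = synthesisSchwartz F ψ + synthesisSchwartz F φ := by
  ext x
  rw [add_apply]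
  simp only [synthesisSchwartz_apply]
  rw [← integral_add (integrable_synthesisKernel F ψ x) (integrable_synthesisKernel F φ x)]
  simp [synthesisKernel, shearletRep, mul_add]

theorem synthesisSchwartz_smul_right (c : ℂ) (F : ShearletSchwartz) (ψ : 𝓢(Plane, ℂ)) :
    synthesisSchwartz F (c • ψ) = c • synthesisSchwartz F ψ := by
  ext x
  rw [smul_apply]
  simp only [synthesisSchwartz_apply]
  rw [← integral_smul]
  simp [synthesisKernel, shearletRep, mul_left_comm]

/-! ### Vanishing moments -/

theorem integral_monomial_mul_synthesisKernel (m : Fin 2 → ℕ) (F : ShearletSchwartz)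
    (ψ : lizorkinSpace 2) (p : ShearletGroup) :
    ∫ x : Plane, ((∏ i, x i ^ m i : ℝ) : ℂ) * synthesisKernel F ψ p x = 0 := by
  have h := integral_monomial_mul_lizorkin_comp_affine m (shearletMatrixInv p.2.1 p.2.2)
    (shearletMatrix p.2.1 p.2.2) (shearletMatrix_mul_shearletMatrixInv _ p.2.2.2) p.1 ψ
  have h2 := congrArg ((F p * ((|(p.2.2 : ℝ)| ^ (-(3 / 4) : ℝ) : ℝ) : ℂ)) * ·) h
  simp only [mul_zero] at h2
  rw [← integral_const_mul] at h2
  rw [← h2]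
  refine integral_congr_ae (Filter.Eventually.of_forall fun x => ?_)
  simp only [synthesisKernel_eq, Function.comp_apply, smul_eq_mul]
  exact mul_left_comm _ _ _

theorem norm_monomial_le (m : Fin 2 → ℕ) (x : Plane) :
    ‖((∏ i, x i ^ m i : ℝ) : ℂ)‖ ≤ (1 + ‖x‖) ^ (m 0 + m 1) := by
  have hx : ∀ i, |x i| ≤ 1 + ‖x‖ := fun i => by
    have : |x i| ≤ ‖x‖ := by simpa using PiLp.norm_apply_le x i
    linarith
  rw [Complex.norm_real, Fin.prod_univ_two, norm_mul, norm_pow, norm_pow, pow_add]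
  simp only [Real.norm_eq_abs]
  gcongr
  · exact hx 0
  · exact hx 1

/-- Justifies Fubini for the moments. Of the weight exponent m₀ + m₁ + 3, the monomial uses m₀ + m₁;
the remaining 3 exceeds the dimension 2 and gives integrability over the plane. -/
theorem integrable_monomial_mul_synthesisKernel (m : Fin 2 → ℕ) (F : ShearletSchwartz)
    (ψ : 𝓢(Plane, ℂ)) :
    Integrable (fun q : ShearletGroup × Plane =>
      ((∏ i, q.2 i ^ m i : ℝ) : ℂ) * synthesisKernel F ψ q.1 q.2)
      (shearletHaar.prod volume) := by
  have hJ : Integrable fun x : Plane => (1 + ‖x‖) ^ (-3 : ℝ) :=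
    integrable_one_add_norm (by rw [finrank_euclideanSpace_fin]; norm_num)
  refine ((integrable_inv_shearletSize_pow.const_mul
    (kernelConst (m 0 + m 1 + 3) 0 F ψ)).mul_prod hJ).mono' ?_
    (Filter.Eventually.of_forall fun q => ?_)
  · have := continuous_synthesisKernel F ψ
    exact Continuous.aestronglyMeasurable (by fun_prop)
  · have hx : (0 : ℝ) < 1 + ‖q.2‖ := by positivity
    have h := one_add_norm_pow_mul_iteratedFDeriv_synthesisKernel_le F ψ (m 0 + m 1 + 3) 0 q.1 q.2
    rw [norm_iteratedFDeriv_zero] at h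
    rw [norm_mul, Real.rpow_neg hx.le, ← div_eq_mul_inv, le_div_iff₀ (by positivity)]
    refine le_trans ?_ h
    rw [pow_add, show (1 + ‖q.2‖) ^ (3 : ℝ) = (1 + ‖q.2‖) ^ 3 by norm_cast, mul_right_comm]
    gcongr
    exact norm_monomial_le m q.2

theorem synthesisSchwartz_mem_lizorkinSpace (F : ShearletSchwartz) (ψ : lizorkinSpace 2) :
    synthesisSchwartz F ψ ∈ lizorkinSpace 2 := by
  intro m
  simp only [synthesisSchwartz_apply, ← integral_const_mul]
  rw [← integral_integral_swap (integrable_monomial_mul_synthesisKernel m F ψ)]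
  simp only [integral_monomial_mul_synthesisKernel m F ψ, integral_zero]

/-! ### The continuous bilinear synthesis map -/

/-- The synthesis operator as a bilinear map `S(𝕊) × S₀(ℝ²) → S₀(ℝ²)`. -/
noncomputable def synthesisBilin :
    ShearletSchwartz →ₗ[ℂ] lizorkinSpace 2 →ₗ[ℂ] lizorkinSpace 2 :=
  LinearMap.mk₂ ℂ (fun F ψ => ⟨synthesisSchwartz F ψ, synthesisSchwartz_mem_lizorkinSpace F ψ⟩)
    (fun F G ψ => Subtype.ext (synthesisSchwartz_add_left F G ψ))
    (fun c F ψ => Subtype.ext (synthesisSchwartz_smul_left c F ψ))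
    (fun F ψ φ => Subtype.ext (synthesisSchwartz_add_right F ψ φ))
    (fun c F ψ => Subtype.ext (synthesisSchwartz_smul_right c F ψ))

theorem continuous_synthesisBilin :
    Continuous fun q : ShearletSchwartz × lizorkinSpace 2 => synthesisBilin q.1 q.2 := by
  rw [continuous_iff_continuousAt]
  rintro ⟨F₀, ψ₀⟩
  refine tendsto_subtype_rng.2 (((schwartz_withSeminorms ℂ Plane ℂ).tendsto_nhds _ _).2 ?_)
  rintro ⟨k, n⟩ ε hε
  let Q : Seminorm ℂ ShearletSchwartz := ShearletSchwartz.seminorm (decayIndex (k + n + 6))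
  let R : Seminorm ℂ 𝓢(Plane, ℂ) := (Finset.Iic (k, n)).sup (schwartzSeminormFamily ℂ Plane ℂ)
  let C : ℝ := 2 ^ (k + n + 6) * 3 ^ (k + n) * 2 ^ k * ∫ p, (shearletSize p ^ 5)⁻¹ ∂shearletHaar
  -- Each output seminorm is bounded by a product of one continuous seminorm in each variable.
  have hB : ∀ F ψ, SchwartzMap.seminorm ℂ k n (synthesisSchwartz F ψ) ≤ C * (Q F * R ψ) := by
    intro F ψ
    refine (seminorm_synthesisSchwartz_le F ψ k n).trans_eq ?_
    change 2 ^ (k + n + 6) * 3 ^ (k + n) * 2 ^ k * Q F * R ψ * _ = C * (Q F * R ψ)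
    simp only [C]
    ring
  have hQ : Continuous Q := ShearletSchwartz.withSeminorms.continuous_seminorm (decayIndex _)
  have hR : Continuous R :=
    Seminorm.continuous_finsetSup fun i _ =>
      (schwartz_withSeminorms ℂ Plane ℂ).continuous_seminorm i
  have : IsTopologicalAddGroup ShearletSchwartz :=
    ShearletSchwartz.withSeminorms.topologicalAddGroup
  -- Writing B(F, ψ) - B(F₀, ψ₀) = B(F - F₀, ψ - ψ₀) + B(F - F₀, ψ₀) + B(F₀, ψ - ψ₀), this
  -- continuous function majorizes the seminorm of the difference and vanishes at (F₀, ψ₀).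
  let g : ShearletSchwartz × lizorkinSpace 2 → ℝ := fun q =>
    C * (Q (q.1 - F₀) * R ((q.2 : 𝓢(Plane, ℂ)) - ψ₀)) + C * (Q (q.1 - F₀) * R ψ₀) +
      C * (Q F₀ * R ((q.2 : 𝓢(Plane, ℂ)) - ψ₀))
  have hg : Continuous g := by fun_prop
  have hg0 : g (F₀, ψ₀) = 0 := by simp [g]
  have hlt : ∀ᶠ q in nhds (F₀, ψ₀), g q < ε :=
    hg.continuousAt.eventually_lt continuousAt_const (by rwa [hg0])
  filter_upwards [hlt] with q hq
  refine lt_of_le_of_lt ?_ hq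
  have hsplit : (synthesisBilin q.1 q.2 : 𝓢(Plane, ℂ)) - synthesisBilin F₀ ψ₀ =
      synthesisSchwartz (q.1 - F₀) (q.2 - ψ₀ : lizorkinSpace 2) +
        synthesisSchwartz (q.1 - F₀) ψ₀ + synthesisSchwartz F₀ (q.2 - ψ₀ : lizorkinSpace 2) := by
    change ((synthesisBilin q.1 q.2 - synthesisBilin F₀ ψ₀ : lizorkinSpace 2) : 𝓢(Plane, ℂ)) =
      ((synthesisBilin (q.1 - F₀) (q.2 - ψ₀) + synthesisBilin (q.1 - F₀) ψ₀ +
        synthesisBilin F₀ (q.2 - ψ₀) : lizorkinSpace 2) : 𝓢(Plane, ℂ))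
    congr 1
    simp only [map_sub, LinearMap.sub_apply]
    abel
  rw [hsplit]
  refine (map_add_le_add _ _ _).trans (add_le_add ((map_add_le_add _ _ _).trans
    (add_le_add ?_ ?_)) ?_) <;> exact hB _ _

theorem mainTheorem2 :
    (∀ (F : ShearletSchwartz) (ψ : lizorkinSpace 2) (x : Plane),
      MeasureTheory.Integrable
        (fun p : ShearletGroup => F p * shearletRep p (ψ : SchwartzMap Plane ℂ) x)
        shearletHaar) ∧
    ∃ B : ShearletSchwartz →ₗ[ℂ] lizorkinSpace 2 →ₗ[ℂ] lizorkinSpace 2,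
      (∀ (F : ShearletSchwartz) (ψ : lizorkinSpace 2) (x : Plane),
        (B F ψ : SchwartzMap Plane ℂ) x =
          shearletSynthesis (ψ : SchwartzMap Plane ℂ) F x) ∧
      (Continuous fun q : ShearletSchwartz × lizorkinSpace 2 => B q.1 q.2) ∧
      ∀ ψ : lizorkinSpace 2, Continuous fun F : ShearletSchwartz => B F ψ :=
  ⟨fun F ψ x => integrable_synthesisKernel F ψ x, synthesisBilin, fun _ _ _ => rfl,
    continuous_synthesisBilin,
    fun ψ => continuous_synthesisBilin.comp (Continuous.prodMk_left ψ)⟩
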